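/- Let $M_q$ be the algebra of complex $q\times q$ matrices ($q\ge 1$), $e\in M_q$ a projection, and $M_q^{\otimes 0}:=\mathbb{C}$. Let $\sigma\in M_q\otimes M_q$ be the flip unitary, $\sigma(x\otimes y)\sigma=y\otimes x$, and $F(t):=\frac{1+z_t}{2}1+\frac{1-z_t}{2}\sigma$ with $z_t:=e^{i\pi(1-t)}$, $t\in[0,1]$: a path of unitaries from $\sigma$ to $1$. Define paths of unitaries $U_l:[0,1]\to M_q^{\otimes l}$ ($l\ge1$) by $U_1:=1$ and $U_{l+1}(t):=\big(U_l(t)\otimes e+1\otimes(1-e)\big)\big(1_{M_q^{\otimes (l-1)}}\otimes F(t)\big)$, so that $U_l(1)=1$, and unital embeddings $i_0^l,i_1^l:M_q^{\otimes (l-1)}\to M_q^{\otimes l}$ by $i_1^l(x):=x\otimes 1$ and $i_0^l(x):=U_l(0)(x\otimes 1)U_l(0)^*$. (Then $i_0^{l+1}(x\otimes e+y\otimes(1-e))=i_0^l(x)\otimes e+i_1^l(y)\otimes(1-e)$.) The folding interval algebra $\mathcal{I}^l_{q,e}$ is the pullback $$\mathcal{I}^l_{q,e}:=\{(f,x_0,x_1)\in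 C([0,1],M_q^{\otimes l})\oplus M_q^{\otimes (l-1)}\oplus M_q^{\otimes (l-1)} : f(0)=i_0^l(x_0),\ f(1)=i_1^l(x_1)\},$$ whose elements are identified with the functions $f$. There are unital $^*$-homomorphisms $\mathcal{I}^l_{q,e}\to\mathcal{I}^{l+1}_{q,e}$: the folding map $\Psi(f)(t):=f(t/2)\otimes e+f(1-t/2)\otimes(1-e)$ and, for $s\in[0,1]$, the point evaluation $\mathrm{E}_s(f)(t):=U_{l+1}(t)(f(s)\otimes 1)U_{l+1}(t)^*$. Let $(d_k)_{k\ge0}$ be a sequence with dense range in $[0,1]$, let $p_0=2<p_1<p_2<\cdots$ be the prime numbers, $p_{-1}:=1$, $q_k:=p_kp_{k-1}$, and let $(r_k)_{k\ge0}$ be a strictly increasing sequence of natural numbers with $r_0\geq2$. Let $e_A^k,e_B^k\in M_{q_k}$ be projections of ranks $p_{k-1}$ and $p_k$, respectively. For $e=(e^k)_k$ either $(e_A^k)_k$ or $(e_B^k)_k$, put $[n,i]:=\prod_{j=i}^{n-1}q_i^{r_j}$ and $$A_n(e):=\bigoplus_{i=0}^{n-1}M_{[n,i]}\big(\mathcal{I}^{n-i}_{q_i,e^i}\big)\oplus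 C([0,1]),$$ and let $\phi_n:A_n(e)\to A_{n+1}(e)$ be the unital $^*$-homomorphism that maps (a) the block $M_{[n,i]}(\mathcal{I}^{n-i}_{q_i,e^i})$, $0\le i\le n-1$, to the block $M_{[n+1,i]}(\mathcal{I}^{n+1-i}_{q_i,e^i})$ by $f\mapsto\mathrm{diag}\big(\Psi(f),\mathrm{E}_{1/m}(f),\dots,\mathrm{E}_{(m-1)/m}(f)\big)$ with $m=q_i^{r_n}$, where $\Psi$ and $\mathrm{E}_s$ are applied to the entries of $f$; (b) $f\in C([0,1])$ to the pair of the constant $f(0)\cdot1$ in the new block $M_{q_n^{r_n}}(\mathcal{I}^1_{q_n,e^n})$ and the constant function $f(d_n)$ in $C([0,1])$. Let $A:=\varinjlim(A_n(e_A),\phi_n)$ and $B:=\varinjlim(A_n(e_B),\phi_n)$ be the C*-algebraic inductive limits. **Proposition.** Both $A$ and $B$ are separable and unital and have stable rank one (that is, their invertible elements are dense). -/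

import Mathlib

noncomputable section

/-! ## Stable rank one -/

/-- A unital C⋆-algebra has stable rank one if its invertible elements are dense. -/
def HasStableRankOne (A : Type*) [CStarAlgebra A] : Prop :=
  Dense {a : A | IsUnit a}

/-! ## Inductive limits of sequences of unital C⋆-algebras -/

namespace CStarLimit

variable {A : ℕ → Type*} [∀ n, CStarAlgebra (A n)] (φ : ∀ n, A n →⋆ₐ[ℂ] A (n + 1))

/-- The ⋆-algebra of sequences `(xₙ)` with `xₙ₊₁ = φₙ xₙ` for all large `n`. -/
def coherent : StarSubalgebra ℂ (∀ n, A n) where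
  carrier := {x | ∀ᶠ n in Filter.atTop, φ n (x n) = x (n + 1)}
  mul_mem' {x y} hx hy := by
    filter_upwards [hx, hy] with n h1 h2
    simp [h1, h2]
  add_mem' {x y} hx hy := by
    filter_upwards [hx, hy] with n h1 h2
    simp [h1, h2]
  algebraMap_mem' c := Filter.Eventually.of_forall fun n => by
    simpa [Pi.algebraMap_apply] using AlgHomClass.commutes (φ n) c
  star_mem' {x} hx := by
    filter_upwards [hx] with n h1
    simp [map_star, h1]

/-- A copy of `coherent φ` that carries the algebraic structure only, not the product topology. -/
def Thread : Type _ := coherent φ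

instance : Ring (Thread φ) := inferInstanceAs (Ring (coherent φ))
instance : Algebra ℂ (Thread φ) := inferInstanceAs (Algebra ℂ (coherent φ))
instance : StarRing (Thread φ) := inferInstanceAs (StarRing (coherent φ))
instance : StarModule ℂ (Thread φ) := inferInstanceAs (StarModule ℂ (coherent φ))

variable {φ}

/-- The `n`-th term of a thread. -/
def Thread.term (x : Thread φ) (n : ℕ) : A n := x.1 n

@[simp] theorem Thread.term_add (x y : Thread φ) (n : ℕ) :
    (x + y).term n = x.term n + y.term n := rfl
@[simp] theorem Thread.term_mul (x y : Thread φ) (n : ℕ) :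
    (x * y).term n = x.term n * y.term n := rfl
@[simp] theorem Thread.term_neg (x : Thread φ) (n : ℕ) : (-x).term n = -x.term n := rfl
@[simp] theorem Thread.term_zero (n : ℕ) : (0 : Thread φ).term n = 0 := rfl
@[simp] theorem Thread.term_one (n : ℕ) : (1 : Thread φ).term n = 1 := rfl
@[simp] theorem Thread.term_star (x : Thread φ) (n : ℕ) : (star x).term n = star (x.term n) := rfl
@[simp] theorem Thread.term_smul (c : ℂ) (x : Thread φ) (n : ℕ) :
    (c • x).term n = c • x.term n := rfl

/-- The C⋆-seminorm `‖x‖ = lim ‖xₙ‖` on threads (see `Thread.tendsto_norm`). -/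
instance : Norm (Thread φ) where
  norm x := Filter.limsup (fun n => ‖x.term n‖) Filter.atTop

theorem Thread.tendsto_norm (x : Thread φ) :
    Filter.Tendsto (fun n => ‖x.term n‖) Filter.atTop (nhds ‖x‖) := by
  obtain ⟨N, hN⟩ := Filter.eventually_atTop.1 x.2
  have hanti : Antitone (fun k => ‖x.term (k + N)‖) := antitone_nat_of_succ_le fun k => by
    have h := hN (k + N) (by omega)
    have e : k + 1 + N = k + N + 1 := by omega
    rw [e]
    have h2 : x.term (k + N + 1) = φ (k + N) (x.term (k + N)) := h.symm
    rw [h2]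
    exact NonUnitalStarAlgHom.norm_apply_le (φ (k + N)) _
  have hbdd : BddBelow (Set.range fun k => ‖x.term (k + N)‖) :=
    ⟨0, by rintro _ ⟨k, rfl⟩; exact norm_nonneg _⟩
  have h1 := tendsto_atTop_ciInf hanti hbdd
  have h2 := (Filter.tendsto_add_atTop_iff_nat (f := fun n => ‖x.term n‖) N).1 h1
  have h3 : ‖x‖ = _ := h2.limsup_eq
  rw [h3]
  exact h2

instance : SeminormedRing (Thread φ) :=
  RingSeminorm.toSeminormedRing
    { toFun := fun x => ‖x‖
      map_zero' := tendsto_nhds_unique (Thread.tendsto_norm (0 : Thread φ)) (by simp)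
      add_le' := fun x y => le_of_tendsto_of_tendsto' (x + y).tendsto_norm
        (x.tendsto_norm.add y.tendsto_norm) fun n => norm_add_le _ _
      neg' := fun x => tendsto_nhds_unique (-x).tendsto_norm (by simpa using x.tendsto_norm)
      mul_le' := fun x y => le_of_tendsto_of_tendsto' (x * y).tendsto_norm
        (x.tendsto_norm.mul y.tendsto_norm) fun n => norm_mul_le _ _ }

instance : NormedAlgebra ℂ (Thread φ) where
  norm_smul_le c x := le_of_eq <| tendsto_nhds_unique (c • x).tendsto_norm
    (by simpa [norm_smul] using x.tendsto_norm.const_mul ‖c‖)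

instance : NormedStarGroup (Thread φ) where
  norm_star_le x := le_of_eq <| tendsto_nhds_unique (star x).tendsto_norm
    (by simpa using x.tendsto_norm)

theorem Thread.norm_star_mul_self' (x : Thread φ) : ‖star x * x‖ = ‖x‖ * ‖x‖ :=
  tendsto_nhds_unique (star x * x).tendsto_norm
    (by simpa [CStarRing.norm_star_mul_self] using x.tendsto_norm.mul x.tendsto_norm)

end CStarLimit

/-- The inductive limit, in the category of unital C⋆-algebras, of a sequence
`A 0 → A 1 → A 2 → ⋯`: the Hausdorff completion of the ⋆-algebra of eventually coherent
sequences with respect to the C⋆-seminorm `lim ‖xₙ‖`. -/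
def CStarLimit {A : ℕ → Type*} [∀ n, CStarAlgebra (A n)]
    (φ : ∀ n, A n →⋆ₐ[ℂ] A (n + 1)) : Type _ :=
  UniformSpace.Completion (CStarLimit.Thread φ)

namespace CStarLimit

open UniformSpace

variable {A : ℕ → Type*} [∀ n, CStarAlgebra (A n)] (φ : ∀ n, A n →⋆ₐ[ℂ] A (n + 1))

instance : NormedRing (CStarLimit φ) := inferInstanceAs (NormedRing (Completion (Thread φ)))
instance : CompleteSpace (CStarLimit φ) := inferInstanceAs (CompleteSpace (Completion (Thread φ)))
instance : NormedAlgebra ℂ (CStarLimit φ) where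
  toAlgebra := inferInstanceAs (Algebra ℂ (Completion (Thread φ)))
  norm_smul_le := norm_smul_le (α := ℂ) (β := Completion (Thread φ))

variable {φ}

/-- The class of a thread in the inductive limit. -/
def mk (x : Thread φ) : CStarLimit φ := (x : Completion (Thread φ))

theorem denseRange_mk : DenseRange (mk (φ := φ)) := Completion.denseRange_coe
theorem continuous_mk : Continuous (mk (φ := φ)) := Completion.continuous_coe _
theorem norm_mk (x : Thread φ) : ‖mk x‖ = ‖x‖ := Completion.norm_coe x
theorem mk_add (x y : Thread φ) : mk (x + y) = mk x + mk y := Completion.coe_add x y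
theorem mk_mul (x y : Thread φ) : mk (x * y) = mk x * mk y := Completion.coe_mul x y
theorem mk_one : mk (1 : Thread φ) = 1 := Completion.coe_one _
theorem mk_smul (c : ℂ) (x : Thread φ) : mk (c • x) = c • mk x := Completion.coe_smul c x

instance : Star (CStarLimit φ) where
  star := (Completion.map star : Completion (Thread φ) → Completion (Thread φ))

theorem mk_star (x : Thread φ) : mk (star x) = star (mk x) :=
  (Completion.map_coe (f := (star : Thread φ → Thread φ)) star_isometry.uniformContinuous x).symm

theorem continuous_star' : Continuous (star : CStarLimit φ → CStarLimit φ) :=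
  Completion.continuous_map

instance : ContinuousStar (CStarLimit φ) := ⟨continuous_star'⟩

theorem ind {p : CStarLimit φ → Prop} (hp : IsClosed {x | p x})
    (h : ∀ x : Thread φ, p (mk x)) (x : CStarLimit φ) : p x :=
  denseRange_mk.induction_on x hp h

instance : StarRing (CStarLimit φ) where
  star_involutive := ind (p := fun x => star (star x) = x)
    (isClosed_eq (by fun_prop) (by fun_prop)) fun x => by
      rw [← mk_star, ← mk_star, star_star]
  star_mul x y := by
    refine ind (p := fun x => star (x * y) = star y * star x)
      (isClosed_eq (by fun_prop) (by fun_prop)) (fun x => ?_) x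
    refine ind (p := fun y => star (mk x * y) = star y * star (mk x))
      (isClosed_eq (by fun_prop) (by fun_prop)) (fun y => ?_) y
    rw [← mk_mul, ← mk_star, star_mul, mk_mul, mk_star, mk_star]
  star_add x y := by
    refine ind (p := fun x => star (x + y) = star x + star y)
      (isClosed_eq (by fun_prop) (by fun_prop)) (fun x => ?_) x
    refine ind (p := fun y => star (mk x + y) = star (mk x) + star y)
      (isClosed_eq (by fun_prop) (by fun_prop)) (fun y => ?_) y
    rw [← mk_add, ← mk_star, star_add, mk_add, mk_star, mk_star]

theorem star_smul' (c : ℂ) (x : CStarLimit φ) : star (c • x) = star c • star x := by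
  have h (c : ℂ) : Continuous fun x : CStarLimit φ => c • x := by
    simp only [Algebra.smul_def]
    exact continuous_const.mul continuous_id
  refine ind (p := fun x => star (c • x) = star c • star x)
    (isClosed_eq (continuous_star'.comp (h c)) ((h _).comp continuous_star')) (fun x => ?_) x
  rw [← mk_smul, ← mk_star, star_smul, mk_smul, mk_star]

instance : CStarAlgebra (CStarLimit φ) where
  norm_mul_self_le x := by
    refine le_of_eq <| Eq.symm <| ind (p := fun x => ‖star x * x‖ = ‖x‖ * ‖x‖)
      (isClosed_eq (by fun_prop) (by fun_prop)) (fun x => ?_) x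
    rw [← mk_star, ← mk_mul, norm_mk, norm_mk, Thread.norm_star_mul_self']
  star_smul := star_smul'

end CStarLimit

/-! ## Evans–Kishimoto folding interval algebras -/

namespace Folding

open scoped Kronecker Matrix.Norms.L2Operator unitInterval CStarAlgebra
open Matrix

/-- The index set of the standard basis of `(ℂ^q)^{⊗ l}`. -/
def Idx (q : ℕ) : ℕ → Type
  | 0 => Unit
  | l + 1 => Idx q l × Fin q

instance Idx.instFintype (q : ℕ) : ∀ l, Fintype (Idx q l)
  | 0 => inferInstanceAs (Fintype Unit)
  | l + 1 => @instFintypeProd _ _ (Idx.instFintype q l) _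

instance Idx.instDecidableEq (q : ℕ) : ∀ l, DecidableEq (Idx q l)
  | 0 => inferInstanceAs (DecidableEq Unit)
  | l + 1 => @instDecidableEqProd _ _ (Idx.instDecidableEq q l) _

theorem Idx.card (q l : ℕ) : Fintype.card (Idx q l) = q ^ l := by
  induction l with
  | zero => rfl
  | succ l ih =>
    rw [pow_succ, ← ih]
    exact (Fintype.card_prod (Idx q l) (Fin q)).trans (by simp)

/-- The algebra `M_q^{⊗ l}`, with the C⋆-norm. -/
abbrev Mat (q l : ℕ) : Type := Matrix (Idx q l) (Idx q l) ℂ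

/-- The elementary tensor `x ⊗ y`, as an element of `M_q^{⊗ (l+1)} = M_q^{⊗ l} ⊗ M_q`. -/
def tmul {q l : ℕ} (x : Mat q l) (y : Matrix (Fin q) (Fin q) ℂ) : Mat q (l + 1) := x ⊗ₖ y

/-- A projection of `M_q`. -/
def Proj (q : ℕ) : Type := {e : Matrix (Fin q) (Fin q) ℂ // IsStarProjection e}

section tmul

variable {q l : ℕ} (x x' : Mat q l) (y y' : Matrix (Fin q) (Fin q) ℂ)

theorem tmul_mul : tmul x y * tmul x' y' = tmul (x * x') (y * y') :=
  (mul_kronecker_mul x x' y y').symm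
theorem tmul_star : star (tmul x y) = tmul (star x) (star y) :=
  conjTranspose_kronecker x y
theorem one_tmul_one : tmul (1 : Mat q l) 1 = 1 := one_kronecker_one
theorem tmul_add : tmul x (y + y') = tmul x y + tmul x y' := kronecker_add x y y'
theorem add_tmul : tmul (x + x') y = tmul x y + tmul x' y := add_kronecker x x' y
theorem smul_tmul (c : ℂ) : tmul (c • x) y = c • tmul x y := smul_kronecker c x y
theorem zero_tmul : tmul (0 : Mat q l) y = 0 := zero_kronecker y
theorem tmul_zero : tmul x (0 : Matrix (Fin q) (Fin q) ℂ) = 0 := kronecker_zero x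

/-- The embedding `x ↦ x ⊗ 1` of `M_q^{⊗ l}` into `M_q^{⊗ (l+1)}`. -/
def tmulOne (q l : ℕ) : Mat q l →⋆ₐ[ℂ] Mat q (l + 1) where
  toFun x := tmul x 1
  map_one' := one_tmul_one
  map_mul' x x' := by rw [tmul_mul, one_mul]
  map_zero' := zero_tmul 1
  map_add' x x' := add_tmul x x' 1
  commutes' c := by rw [Algebra.algebraMap_eq_smul_one, smul_tmul, one_tmul_one,
    Algebra.algebraMap_eq_smul_one]
  map_star' x := by rw [tmul_star, star_one]

end tmul

/-- The homomorphism `(a, b) ↦ a ⊗ e + b ⊗ (1 - e)` from `M_q^{⊗ l} ⊕ M_q^{⊗ l}` to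
`M_q^{⊗ (l+1)}`. -/
def pinch {q : ℕ} (e : Proj q) (l : ℕ) : (Mat q l × Mat q l) →⋆ₐ[ℂ] Mat q (l + 1) where
  toFun x := tmul x.1 e.1 + tmul x.2 (1 - e.1)
  map_one' := by rw [Prod.fst_one, Prod.snd_one, ← tmul_add, add_sub_cancel, one_tmul_one]
  map_mul' x y := by
    have h1 := e.2.isIdempotentElem.eq
    have h2 := e.2.one_sub.isIdempotentElem.eq
    have h3 := e.2.mul_one_sub_self
    have h4 := e.2.one_sub_mul_self
    simp only [Prod.fst_mul, Prod.snd_mul, mul_add, add_mul, tmul_mul, h1, h2, h3, h4, tmul_zero,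
      add_zero, zero_add]
  map_zero' := by simp [zero_tmul]
  map_add' x y := by simp only [Prod.fst_add, Prod.snd_add, add_tmul]; abel
  commutes' c := by
    simp only [Algebra.algebraMap_eq_smul_one, Prod.smul_fst, Prod.smul_snd, Prod.fst_one,
      Prod.snd_one, smul_tmul]
    rw [← smul_add, ← tmul_add, add_sub_cancel, one_tmul_one]
  map_star' x := by
    have h1 : star e.1 = e.1 := e.2.isSelfAdjoint
    simp only [star_add, tmul_star, star_sub, star_one, h1, Prod.fst_star, Prod.snd_star]

/-- Conjugation `x ↦ u x u*` by a unitary. -/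
def conj {q l : ℕ} (u : Mat q l) (hu : u ∈ unitary (Mat q l)) : Mat q l →⋆ₐ[ℂ] Mat q l where
  toFun x := u * x * star u
  map_one' := by rw [mul_one, Unitary.mul_star_self_of_mem hu]
  map_mul' x y := by
    have h := Unitary.star_mul_self_of_mem hu
    calc u * (x * y) * star u = u * x * 1 * y * star u := by simp only [mul_one, mul_assoc]
      _ = u * x * star u * (u * y * star u) := by rw [← h]; simp only [mul_assoc]
  map_zero' := by simp
  map_add' x y := by simp only [mul_add, add_mul]
  commutes' c := by
    rw [← Algebra.commutes, mul_assoc, Unitary.mul_star_self_of_mem hu, mul_one]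
  map_star' x := by simp only [star_mul, star_star, mul_assoc]

/-- The transposition of the last two of `l + 2` tensor legs. -/
def swapLast (q l : ℕ) : Equiv.Perm (Idx q (l + 2)) where
  toFun a := ((a.1.1, a.2), a.1.2)
  invFun a := ((a.1.1, a.2), a.1.2)
  left_inv _ := rfl
  right_inv _ := rfl

/-- The flip unitary `x ⊗ y ⊗ z ↦ x ⊗ z ⊗ y` of `(ℂ^q)^{⊗ l} ⊗ ℂ^q ⊗ ℂ^q`. -/
def flip (q l : ℕ) : Mat q (l + 2) := (swapLast q l).permMatrix ℂ

theorem flip_star (q l : ℕ) : star (flip q l) = flip q l :=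
  Matrix.conjTranspose_permMatrix (R := ℂ) (swapLast q l)

theorem flip_mul_flip (q l : ℕ) : flip q l * flip q l = 1 := by
  have h := Matrix.permMatrix_mul (R := ℂ) (swapLast q l) (swapLast q l)
  have h2 : swapLast q l * swapLast q l = 1 := Equiv.ext fun _ => rfl
  rw [h2, Matrix.permMatrix_one] at h
  exact h.symm

theorem flip_conj (q l : ℕ) (x : Mat q l) (y z : Matrix (Fin q) (Fin q) ℂ) :
    flip q l * tmul (tmul x y) z * flip q l = tmul (tmul x z) y := by
  have h1 := PEquiv.toMatrix_toPEquiv_mul (swapLast q l) (tmul (tmul x y) z)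
  have h2 := PEquiv.mul_toMatrix_toPEquiv (flip q l * tmul (tmul x y) z) (swapLast q l)
  refine h2.trans ?_
  rw [show flip q l * tmul (tmul x y) z = _ from h1]
  ext ⟨⟨a, b⟩, c⟩ ⟨⟨a', b'⟩, c'⟩
  change x a a' * y c c' * z b b' = x a a' * z b b' * y c c'
  ring

/-- The scalar `exp(iπ(1-t))`: it is `-1` at `t = 0` and `1` at `t = 1`. -/
def phase (t : I) : ℂ := Complex.exp ((Real.pi * (1 - (t : ℝ)) : ℝ) * Complex.I)

/-- A path of unitaries from `flip` (at `t = 0`) to `1` (at `t = 1`). -/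
def flipPath (q l : ℕ) (t : I) : Mat q (l + 2) :=
  ((1 + phase t) / 2) • 1 + ((1 - phase t) / 2) • flip q l

theorem phase_mul_star (t : I) : phase t * star (phase t) = 1 := by
  rw [phase, Complex.star_def, ← Complex.exp_conj, ← Complex.exp_add]
  simp

theorem flipPath_zero (q l : ℕ) : flipPath q l 0 = flip q l := by
  have h : phase 0 = -1 := by simp [phase]
  simp only [flipPath, h]
  norm_num

theorem flipPath_one (q l : ℕ) : flipPath q l 1 = 1 := by
  have h : phase 1 = 1 := by simp [phase]
  simp only [flipPath, h]
  norm_num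

theorem flipPath_mem (q l : ℕ) (t : I) : flipPath q l t ∈ unitary (Mat q (l + 2)) := by
  have h := phase_mul_star t
  have hs : star (flipPath q l t) =
      ((1 + star (phase t)) / 2) • 1 + ((1 - star (phase t)) / 2) • flip q l := by
    simp [flipPath, flip_star]
  have key (a b : ℂ) (hab : a * b = 1) :
      (((1 + a) / 2) • (1 : Mat q (l + 2)) + ((1 - a) / 2) • flip q l) *
        (((1 + b) / 2) • 1 + ((1 - b) / 2) • flip q l) = 1 := by
    simp only [add_mul, mul_add, smul_mul_smul_comm, flip_mul_flip, mul_one, one_mul]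
    have h1 : (1 + a) / 2 * ((1 + b) / 2) + (1 - a) / 2 * ((1 - b) / 2) = 1 := by
      linear_combination hab / 2
    have h2 : (1 - a) / 2 * ((1 + b) / 2) + (1 + a) / 2 * ((1 - b) / 2) = 0 := by
      linear_combination - hab / 2
    calc _ = ((1 + a) / 2 * ((1 + b) / 2) + (1 - a) / 2 * ((1 - b) / 2)) • (1 : Mat q (l + 2)) +
          ((1 - a) / 2 * ((1 + b) / 2) + (1 + a) / 2 * ((1 - b) / 2)) • flip q l := by module
      _ = 1 := by rw [h1, h2, one_smul, zero_smul, add_zero]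
  rw [Unitary.mem_iff, hs]
  exact ⟨key _ _ (by rw [mul_comm]; exact h), key _ _ h⟩

theorem continuous_flipPath (q l : ℕ) : Continuous (flipPath q l) := by
  have h : Continuous phase := by unfold phase; fun_prop
  unfold flipPath
  exact (((continuous_const.add h).div_const 2).smul continuous_const).add
    (((continuous_const.sub h).div_const 2).smul continuous_const)

/-- Paths of unitaries `U_l` in `M_q^{⊗ (l+1)}` with `U_l(1) = 1`, defined by `U_0 = 1` and
`U_{l+1}(t) = (U_l(t) ⊗ e + 1 ⊗ (1 - e)) F(t)`, with `F` the path `flipPath`. -/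
def twist {q : ℕ} (e : Proj q) : ∀ l : ℕ, I → Mat q (l + 1)
  | 0, _ => 1
  | l + 1, t => pinch e (l + 1) (twist e l t, 1) * flipPath q l t

section twist

variable {q : ℕ} (e : Proj q)

theorem twist_mem (l : ℕ) (t : I) : twist e l t ∈ unitary (Mat q (l + 1)) := by
  induction l with
  | zero => exact one_mem _
  | succ l ih =>
    refine mul_mem ?_ (flipPath_mem q l t)
    have h : ((twist e l t, 1) : Mat q (l + 1) × Mat q (l + 1)) ∈ unitary _ := by
      rw [Unitary.mem_iff] at ih ⊢
      exact ⟨Prod.ext ih.1 (by simp), Prod.ext ih.2 (by simp)⟩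
    exact Unitary.map_mem (pinch e (l + 1)) h

theorem twist_one (l : ℕ) : twist e l 1 = 1 := by
  induction l with
  | zero => rfl
  | succ l ih =>
    rw [twist, ih, flipPath_one, mul_one]
    exact map_one (pinch e (l + 1))

theorem continuous_twist (l : ℕ) : Continuous (twist e l) := by
  induction l with
  | zero => exact continuous_const
  | succ l ih =>
    have h : Continuous fun t => pinch e (l + 1) (twist e l t, 1) :=
      (map_continuous (pinch e (l + 1))).comp (ih.prodMk continuous_const)
    exact h.mul (continuous_flipPath q l)

/-- The unital embedding `i₀ : M_q^{⊗ l} → M_q^{⊗ (l+1)}`, `i₀(x) = U_l(0) (x ⊗ 1) U_l(0)*`.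
The recursive relation that governs it is `embZero_pinch`. -/
def embZero (l : ℕ) : Mat q l →⋆ₐ[ℂ] Mat q (l + 1) :=
  (conj (twist e l 0) (twist_mem e l 0)).comp (tmulOne q l)

/-- The unital embedding `i₁ : M_q^{⊗ l} → M_q^{⊗ (l+1)}`, `i₁(x) = x ⊗ 1`. -/
def embOne (q l : ℕ) : Mat q l →⋆ₐ[ℂ] Mat q (l + 1) := tmulOne q l

/-- `i₀(a ⊗ e + b ⊗ (1 - e)) = i₀(a) ⊗ e + i₁(b) ⊗ (1 - e)`. -/
theorem embZero_pinch (l : ℕ) (x : Mat q l × Mat q l) :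
    embZero e (l + 1) (pinch e l x) = pinch e (l + 1) (embZero e l x.1, embOne q l x.2) := by
  have h1 : flip q l * tmul (pinch e l x) 1 * flip q l =
      pinch e (l + 1) (tmul x.1 1, tmul x.2 1) := by
    change flip q l * tmul (tmul x.1 e.1 + tmul x.2 (1 - e.1)) 1 * flip q l = _
    rw [add_tmul, mul_add, add_mul, flip_conj, flip_conj]
    rfl
  change twist e (l + 1) 0 * tmul (pinch e l x) 1 * star (twist e (l + 1) 0) = _
  rw [twist, flipPath_zero, star_mul, flip_star]
  have h2 : (twist e l 0, 1) * (tmul x.1 1, tmul x.2 1) * star (twist e l 0, 1) =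
      (embZero e l x.1, embOne q l x.2) := by
    have h3 : (1 : Mat q (l + 1)) * tmul x.2 1 * star 1 = embOne q l x.2 := by
      rw [star_one, one_mul, mul_one]
      rfl
    have h4 : twist e l 0 * tmul x.1 1 * star (twist e l 0) = embZero e l x.1 := rfl
    have h5 : star ((twist e l 0, 1) : Mat q (l + 1) × Mat q (l + 1)) =
        (star (twist e l 0), star 1) := rfl
    rw [h5, Prod.mk_mul_mk, Prod.mk_mul_mk, h3, h4]
  rw [← h2, map_mul, map_mul, map_star, ← h1]
  simp only [mul_assoc]

/-- `f ↦ (f(0), f(1))`, on `C([0,1], M_q^{⊗ (l+1)}) ⊕ (M_q^{⊗ l} ⊕ M_q^{⊗ l})`. -/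
def evEnds (q l : ℕ) : (C(I, Mat q (l + 1)) × (Mat q l × Mat q l)) →⋆ₐ[ℂ]
    (Mat q (l + 1) × Mat q (l + 1)) where
  toFun x := (x.1 0, x.1 1)
  map_one' := rfl
  map_mul' _ _ := rfl
  map_zero' := rfl
  map_add' _ _ := rfl
  commutes' _ := rfl
  map_star' _ := rfl

/-- `(x₀, x₁) ↦ (i₀(x₀), i₁(x₁))`, on `C([0,1], M_q^{⊗ (l+1)}) ⊕ (M_q^{⊗ l} ⊕ M_q^{⊗ l})`. -/
def embEnds (l : ℕ) : (C(I, Mat q (l + 1)) × (Mat q l × Mat q l)) →⋆ₐ[ℂ]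
    (Mat q (l + 1) × Mat q (l + 1)) where
  toFun x := (embZero e l x.2.1, embOne q l x.2.2)
  map_one' := by simp
  map_mul' _ _ := by simp
  map_zero' := by simp
  map_add' _ _ := by simp
  commutes' c := Prod.ext (AlgHomClass.commutes (embZero e l) c) (AlgHomClass.commutes (embOne q l) c)
  map_star' x := Prod.ext (map_star (embZero e l) x.2.1) (map_star (embOne q l) x.2.2)

theorem isClosed_foldingAlgebra (l : ℕ) :
    IsClosed (SetLike.coe (StarAlgHom.equalizer (evEnds q l) (embEnds e l))) :=
  isClosed_eq (map_continuous (evEnds q l)) (map_continuous (embEnds e l))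

/-- The folding interval algebra `𝓘^{l+1}_{q,e}`: the pullback of
`(ev₀, ev₁) : C([0,1], M_q^{⊗ (l+1)}) → M_q^{⊗ (l+1)} ⊕ M_q^{⊗ (l+1)}` along
`(i₀, i₁) : M_q^{⊗ l} ⊕ M_q^{⊗ l} → M_q^{⊗ (l+1)} ⊕ M_q^{⊗ (l+1)}`.
Note the shift by one in the exponent. -/
def FoldingAlgebra (l : ℕ) : Type := StarAlgHom.equalizer (evEnds q l) (embEnds e l)

instance (l : ℕ) : CStarAlgebra (FoldingAlgebra e l) :=
  @StarSubalgebra.cstarAlgebra _ _ _ _ _ _ _ (StarAlgHom.equalizer (evEnds q l) (embEnds e l))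
    (isClosed_foldingAlgebra e l)

instance (l : ℕ) : PartialOrder (FoldingAlgebra e l) := CStarAlgebra.spectralOrder _
instance (l : ℕ) : StarOrderedRing (FoldingAlgebra e l) := CStarAlgebra.spectralOrderedRing _

/-- The path `ξ₀(t) = t/2`. -/
def xiZero : C(I, I) where
  toFun t := ⟨t / 2, by constructor <;> linarith [t.2.1, t.2.2]⟩

/-- The path `ξ₁(t) = 1 - t/2`. -/
def xiOne : C(I, I) where
  toFun t := ⟨1 - t / 2, by constructor <;> linarith [t.2.1, t.2.2]⟩

/-- `f ↦ f(ξ₀) ⊗ e + f(ξ₁) ⊗ (1 - e)`, before restriction to the folding algebras. The end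
point data `(x₀, x₁)` are sent to `(x₀ ⊗ e + x₁ ⊗ (1 - e), f(1/2))`. -/
def foldPre (l : ℕ) : (C(I, Mat q (l + 1)) × (Mat q l × Mat q l)) →⋆ₐ[ℂ]
    (C(I, Mat q (l + 2)) × (Mat q (l + 1) × Mat q (l + 1))) where
  toFun x := (⟨fun t => pinch e (l + 1) (x.1 (xiZero t), x.1 (xiOne t)),
      (map_continuous (pinch e (l + 1))).comp (by fun_prop)⟩,
      (pinch e l x.2, x.1 (xiZero 1)))
  map_one' := Prod.ext (ContinuousMap.ext fun _ => map_one (pinch e (l + 1)))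
    (Prod.ext (map_one (pinch e l)) rfl)
  map_mul' x y := Prod.ext (ContinuousMap.ext fun t => map_mul (pinch e (l + 1))
    (x.1 (xiZero t), x.1 (xiOne t)) (y.1 (xiZero t), y.1 (xiOne t)))
    (Prod.ext (map_mul (pinch e l) x.2 y.2) rfl)
  map_zero' := Prod.ext (ContinuousMap.ext fun _ => map_zero (pinch e (l + 1)))
    (Prod.ext (map_zero (pinch e l)) rfl)
  map_add' x y := Prod.ext (ContinuousMap.ext fun t => map_add (pinch e (l + 1))
    (x.1 (xiZero t), x.1 (xiOne t)) (y.1 (xiZero t), y.1 (xiOne t)))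
    (Prod.ext (map_add (pinch e l) x.2 y.2) rfl)
  commutes' c := Prod.ext (ContinuousMap.ext fun _ => AlgHomClass.commutes (pinch e (l + 1)) c)
    (Prod.ext (AlgHomClass.commutes (pinch e l) c) rfl)
  map_star' x := Prod.ext (ContinuousMap.ext fun t => map_star (pinch e (l + 1))
    (x.1 (xiZero t), x.1 (xiOne t))) (Prod.ext (map_star (pinch e l) x.2) rfl)

theorem foldPre_mem (l : ℕ) (x : C(I, Mat q (l + 1)) × (Mat q l × Mat q l))
    (hx : x ∈ StarAlgHom.equalizer (evEnds q l) (embEnds e l)) :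
    foldPre e l x ∈ StarAlgHom.equalizer (evEnds q (l + 1)) (embEnds e (l + 1)) := by
  have hx' : (x.1 0, x.1 1) = (embZero e l x.2.1, embOne q l x.2.2) := hx
  have z0 : xiZero 0 = 0 := Subtype.ext (by simp [xiZero])
  have z1 : xiOne 0 = 1 := Subtype.ext (by simp [xiOne])
  have z2 : xiOne 1 = xiZero 1 := Subtype.ext (by simp [xiOne, xiZero]; norm_num)
  refine Prod.ext ?_ ?_
  · change pinch e (l + 1) (x.1 (xiZero 0), x.1 (xiOne 0)) = embZero e (l + 1) (pinch e l x.2)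
    rw [z0, z1, hx', embZero_pinch]
  · change pinch e (l + 1) (x.1 (xiZero 1), x.1 (xiOne 1)) = tmul (x.1 (xiZero 1)) 1
    rw [z2]
    change tmul _ e.1 + tmul _ (1 - e.1) = _
    rw [← tmul_add, add_sub_cancel]

/-- The folding map `𝓘^{l+1}_{q,e} → 𝓘^{l+2}_{q,e}`, `f ↦ f(ξ₀) ⊗ e + f(ξ₁) ⊗ (1 - e)`. -/
def foldMap (l : ℕ) : FoldingAlgebra e l →⋆ₐ[ℂ] FoldingAlgebra e (l + 1) :=
  StarAlgHom.codRestrict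
    ((foldPre e l).comp (StarAlgHom.equalizer (evEnds q l) (embEnds e l)).subtype)
    (StarAlgHom.equalizer (evEnds q (l + 1)) (embEnds e (l + 1)))
    fun x => foldPre_mem e l x.1 x.2

/-- `f ↦ (t ↦ U_{l+1}(t) (f(s) ⊗ 1) U_{l+1}(t)*)`, before restriction to the folding algebras. -/
def pointPre (l : ℕ) (s : I) : (C(I, Mat q (l + 1)) × (Mat q l × Mat q l)) →⋆ₐ[ℂ]
    (C(I, Mat q (l + 2)) × (Mat q (l + 1) × Mat q (l + 1))) where
  toFun x := (⟨fun t => conj (twist e (l + 1) t) (twist_mem e (l + 1) t) (tmulOne q (l + 1) (x.1 s)),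
      ((continuous_twist e (l + 1)).mul continuous_const).mul (continuous_twist e (l + 1)).star⟩,
      (x.1 s, x.1 s))
  map_one' := Prod.ext (ContinuousMap.ext fun _ =>
    map_one ((conj _ (twist_mem e (l + 1) _)).comp (tmulOne q (l + 1)))) rfl
  map_mul' x y := Prod.ext (ContinuousMap.ext fun _ =>
    map_mul ((conj _ (twist_mem e (l + 1) _)).comp (tmulOne q (l + 1))) (x.1 s) (y.1 s)) rfl
  map_zero' := Prod.ext (ContinuousMap.ext fun _ =>
    map_zero ((conj _ (twist_mem e (l + 1) _)).comp (tmulOne q (l + 1)))) rfl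
  map_add' x y := Prod.ext (ContinuousMap.ext fun _ =>
    map_add ((conj _ (twist_mem e (l + 1) _)).comp (tmulOne q (l + 1))) (x.1 s) (y.1 s)) rfl
  commutes' c := Prod.ext (ContinuousMap.ext fun _ => AlgHomClass.commutes
    ((conj _ (twist_mem e (l + 1) _)).comp (tmulOne q (l + 1))) c) rfl
  map_star' x := Prod.ext (ContinuousMap.ext fun _ =>
    map_star ((conj _ (twist_mem e (l + 1) _)).comp (tmulOne q (l + 1))) (x.1 s)) rfl

theorem pointPre_mem (l : ℕ) (s : I) (x : C(I, Mat q (l + 1)) × (Mat q l × Mat q l)) :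
    pointPre e l s x ∈ StarAlgHom.equalizer (evEnds q (l + 1)) (embEnds e (l + 1)) := by
  refine Prod.ext rfl ?_
  change twist e (l + 1) 1 * tmul (x.1 s) 1 * star (twist e (l + 1) 1) = tmul (x.1 s) 1
  rw [twist_one, star_one, mul_one, one_mul]

/-- The point evaluation `𝓘^{l+1}_{q,e} → 𝓘^{l+2}_{q,e}` at `s`,
`f ↦ (t ↦ U_{l+1}(t) (f(s) ⊗ 1) U_{l+1}(t)*)`. The unitaries `U_{l+1}(t)` turn the constant
function `f(s) ⊗ 1` into a function that satisfies the boundary conditions of `𝓘^{l+2}_{q,e}`. -/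
def pointMap (l : ℕ) (s : I) : FoldingAlgebra e l →⋆ₐ[ℂ] FoldingAlgebra e (l + 1) :=
  StarAlgHom.codRestrict
    ((pointPre e l s).comp (StarAlgHom.equalizer (evEnds q l) (embEnds e l)).subtype)
    (StarAlgHom.equalizer (evEnds q (l + 1)) (embEnds e (l + 1)))
    fun x => pointPre_mem e l s x.1

end twist

/-- Block-diagonal amplification: the map `M_N(A) → M_{N × o}(B)` that sends `x` to the block
diagonal matrix with the blocks `θ_k(x)` (`θ_k` applied to every entry), `k ∈ o`. -/
def blockDiag {N o : Type} [Fintype N] [DecidableEq N] [Fintype o] [DecidableEq o]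
    {A B : Type} [CStarAlgebra A] [CStarAlgebra B] [PartialOrder A] [StarOrderedRing A]
    [PartialOrder B] [StarOrderedRing B] (θ : o → (A →⋆ₐ[ℂ] B)) :
    CStarMatrix N N A →⋆ₐ[ℂ] CStarMatrix (N × o) (N × o) B where
  toFun x := CStarMatrix.ofMatrix
    (Matrix.blockDiagonal fun k => (CStarMatrix.ofMatrix.symm x).map (θ k))
  map_one' := by
    ext ⟨a, k⟩ ⟨b, k'⟩
    change (if k = k' then θ k ((1 : Matrix N N A) a b) else 0) = (1 : Matrix (N × o) (N × o) B) _ _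
    by_cases h : k = k' <;> by_cases h' : a = b <;> simp [Matrix.one_apply, h, h']
  map_mul' x y := by
    have h : (fun k => (CStarMatrix.ofMatrix.symm (x * y)).map (θ k)) = fun k =>
        (CStarMatrix.ofMatrix.symm x).map (θ k) * (CStarMatrix.ofMatrix.symm y).map (θ k) :=
      funext fun k => Matrix.map_mul (f := (θ k : A →+* B))
        (L := CStarMatrix.ofMatrix.symm x) (M := CStarMatrix.ofMatrix.symm y)
    rw [h, Matrix.blockDiagonal_mul]
    rfl
  map_zero' := by
    ext ⟨a, k⟩ ⟨b, k'⟩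
    change (if k = k' then θ k 0 else 0) = 0
    simp
  map_add' x y := by
    ext ⟨a, k⟩ ⟨b, k'⟩
    change (if k = k' then θ k (x a b + y a b) else 0) =
      (if k = k' then θ k (x a b) else 0) + (if k = k' then θ k (y a b) else 0)
    by_cases h : k = k' <;> simp [h]
  commutes' c := by
    ext ⟨a, k⟩ ⟨b, k'⟩
    change (if k = k' then θ k (if a = b then algebraMap ℂ A c else 0) else 0) =
      if (a, k) = (b, k') then algebraMap ℂ B c else 0
    by_cases h : k = k' <;> by_cases h' : a = b <;> simp [h, h', AlgHomClass.commutes]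
  map_star' x := by
    ext ⟨a, k⟩ ⟨b, k'⟩
    change (if k = k' then θ k (star (x b a)) else 0) = star (if k' = k then θ k' (x b a) else 0)
    by_cases h : k = k'
    · subst h; simp [map_star]
    · simp [h, Ne.symm h]

end Folding

/-! ## The inductive sequences -/

namespace Folding

open scoped unitInterval

/-- `p_k`: the prime numbers in increasing order, `p_0 = 2`. -/
def prm (k : ℕ) : ℕ := Nat.nth Nat.Prime k

/-- `p_{k-1}`, with the convention `p_{-1} = 1`. -/
def prmPred : ℕ → ℕ
  | 0 => 1
  | k + 1 => prm k

/-- `q_k = p_k p_{k-1}`. -/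
def qq (k : ℕ) : ℕ := prm k * prmPred k

/-- An index set with `[i+l+1, i] = ∏_{j=i}^{i+l} q_i^{r_j}` elements (see `Ord.card`). -/
def Ord (r : ℕ → ℕ) (i : ℕ) : ℕ → Type
  | 0 => Fin (qq i ^ r i)
  | l + 1 => Ord r i l × Fin (qq i ^ r (i + l + 1))

instance Ord.instFintype (r : ℕ → ℕ) (i : ℕ) : ∀ l, Fintype (Ord r i l)
  | 0 => inferInstanceAs (Fintype (Fin _))
  | l + 1 => @instFintypeProd _ _ (Ord.instFintype r i l) _

instance Ord.instDecidableEq (r : ℕ → ℕ) (i : ℕ) : ∀ l, DecidableEq (Ord r i l)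
  | 0 => inferInstanceAs (DecidableEq (Fin _))
  | l + 1 => @instDecidableEqProd _ _ (Ord.instDecidableEq r i l) _

theorem Ord.card (r : ℕ → ℕ) (i l : ℕ) :
    Fintype.card (Ord r i l) = ∏ j ∈ Finset.Ico i (i + l + 1), qq i ^ r j := by
  induction l with
  | zero =>
    rw [Nat.add_zero, Nat.Ico_succ_singleton, Finset.prod_singleton]
    exact Fintype.card_fin (qq i ^ r i)
  | succ l ih =>
    rw [show i + (l + 1) + 1 = i + l + 1 + 1 from rfl, Finset.prod_Ico_succ_top (by omega), ← ih]
    exact (Fintype.card_prod (Ord r i l) (Fin _)).trans (by simp)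

section

variable (d : ℕ → I) (r : ℕ → ℕ) (e : ∀ k, Proj (qq k))

/-- The block `M_{[n,i]}(𝓘^{n-i}_{q_i,e_i})`, where `n = i + l + 1`. -/
abbrev Block (i l : ℕ) : Type :=
  CStarMatrix (Ord r i l) (Ord r i l) (FoldingAlgebra (e i) l)

/-- The point `k / m` of `[0,1]`, for `k < m`. -/
def gridPoint {m : ℕ} (k : Fin m) : I :=
  ⟨(k : ℝ) / m, by positivity, div_le_one_of_le₀ (by exact_mod_cast k.2.le) (by positivity)⟩

/-- The partial map `M_{[n,i]}(𝓘^{n-i}_{q_i}) → M_{[n+1,i]}(𝓘^{n+1-i}_{q_i})`, where `n = i + l + 1`: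
block diagonal, with the folding map in the block `k = 0` and the evaluations at the points
`k / q_i^{r_n}` in the blocks `1 ≤ k < q_i^{r_n}`. -/
def growMap (i l : ℕ) : Block r e i l →⋆ₐ[ℂ] Block r e i (l + 1) :=
  blockDiag fun k : Fin (qq i ^ r (i + l + 1)) =>
    if (k : ℕ) = 0 then foldMap (e i) l else pointMap (e i) l (gridPoint k)

/-- The positions of the matrix blocks at stage `n`: the pairs `(i, l)` with `i + l + 1 = n`
(that is, `0 ≤ i ≤ n - 1` and `l + 1 = n - i`). -/
abbrev Slot (n : ℕ) : Type := {p : ℕ × ℕ // p.1 + p.2 + 1 = n}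

instance (n : ℕ) : Finite (Slot n) :=
  Finite.of_injective (β := Fin n × Fin n)
    (fun p => (⟨p.1.1, by have := p.2; omega⟩, ⟨p.1.2, by have := p.2; omega⟩))
    fun p p' h => by
      simp only [Prod.mk.injEq, Fin.mk.injEq] at h
      exact Subtype.ext (Prod.ext h.1 h.2)

instance (n : ℕ) : Fintype (Slot n) := Fintype.ofFinite _

/-- The `n`-th algebra `⊕_{i=0}^{n-1} M_{[n,i]}(𝓘^{n-i}_{q_i,e_i}) ⊕ C([0,1])`. -/
abbrev Stage (n : ℕ) : Type := (∀ p : Slot n, Block r e p.1.1 p.1.2) × C(I, ℂ)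

/-- The homomorphism `C([0,1]) → A`, `f ↦ f(s) 1`. -/
def scalarEv (A : Type) [CStarAlgebra A] (s : I) : C(I, ℂ) →⋆ₐ[ℂ] A where
  toFun f := algebraMap ℂ A (f s)
  map_one' := by simp
  map_mul' _ _ := by simp
  map_zero' := by simp
  map_add' _ _ := by simp
  commutes' _ := rfl
  map_star' f := algebraMap_star_comm (R := ℂ) (A := A) (f s)

/-- The component of the `n`-th connecting map in the matrix block `p` of stage `n + 1`:
`f ↦ f(0) ⊗ 1` on `C([0,1])` for the new block `(n, 0)`, and `growMap` on the block `(i, l)` of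
stage `n` for the block `(i, l + 1)`. -/
def stageComp (n : ℕ) : ∀ p : Slot (n + 1), Stage r e n →⋆ₐ[ℂ] Block r e p.1.1 p.1.2
  | ⟨(i, 0), _⟩ => (scalarEv (Block r e i 0) 0).comp (StarAlgHom.snd ℂ _ _)
  | ⟨(i, l + 1), h⟩ => (growMap r e i l).comp
      { toFun := fun x : Stage r e n => x.1 ⟨(i, l), by simp only at h ⊢; omega⟩
        map_one' := rfl
        map_mul' := fun _ _ => rfl
        map_zero' := rfl
        map_add' := fun _ _ => rfl
        commutes' := fun _ => rfl
        map_star' := fun _ => rfl }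

/-- The `n`-th connecting map. The last summand `C([0,1])` of stage `n` is mapped to the new block
by `f ↦ f(0) ⊗ 1` and to the last summand `C([0,1])` of stage `n + 1` by `f ↦ f(d_n)`. -/
def stageMap (n : ℕ) : Stage r e n →⋆ₐ[ℂ] Stage r e (n + 1) where
  toFun x := (fun p => stageComp r e n p x, scalarEv C(I, ℂ) (d n) x.2)
  map_one' := Prod.ext (funext fun p => map_one (stageComp r e n p))
    (map_one (scalarEv C(I, ℂ) (d n)))
  map_mul' x y := Prod.ext (funext fun p => map_mul (stageComp r e n p) x y)
    (map_mul (scalarEv C(I, ℂ) (d n)) x.2 y.2)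
  map_zero' := Prod.ext (funext fun p => map_zero (stageComp r e n p))
    (map_zero (scalarEv C(I, ℂ) (d n)))
  map_add' x y := Prod.ext (funext fun p => map_add (stageComp r e n p) x y)
    (map_add (scalarEv C(I, ℂ) (d n)) x.2 y.2)
  commutes' c := Prod.ext (funext fun p => AlgHomClass.commutes (stageComp r e n p) c)
    (AlgHomClass.commutes (scalarEv C(I, ℂ) (d n)) c)
  map_star' x := Prod.ext (funext fun p => map_star (stageComp r e n p) x)
    (map_star (scalarEv C(I, ℂ) (d n)) x.2)

/-- The inductive limit of the sequence `Stage r e 0 → Stage r e 1 → ⋯`. -/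
abbrev LimitAlgebra : Type := CStarLimit (stageMap d r e)

end

end Folding

end

noncomputable section

/-! ## Unital injective homomorphisms of C⋆-algebras -/

/-! Both properties pass to inductive limits along unital connecting maps: the images of the stages
are jointly dense, and units are sent to units. They also pass to finite direct sums, so it remains
to treat the blocks $M_N(\mathcal{I}^l_{q,e})$ and $C([0,1])$. Separability of the blocks follows
from second countability of $C([0,1],M_n)$.

For stable rank one, regard an element of a block as a path of scalar matrices together with its end
point data $x_0,x_1$. Matrices have finite spectrum, so adding a small scalar makes the two end
values and the data invertible. What remains is to make the path invertible in between without
moving its ends, since the boundary condition then holds with the same data. This is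
`exists_path_isUnit`: a Bernstein polynomial approximates the path and keeps its ends, its
determinant is a nonzero polynomial, and a slight bend of $[0,1]$ into the complex plane, with ends
fixed, avoids the finitely many zeros. The new element is invertible as a path with data; by
spectral permanence (`StarAlgHom.isUnit_of_isUnit_map`) its inverse lies in the block.
`hasStableRankOne_of_exists_lift` carries out this argument for blocks and for $C([0,1])$ alike. -/

theorem StarAlgHom.isUnit_of_isUnit_map {A B : Type*} [CStarAlgebra A] [CStarAlgebra B]
    (φ : A →⋆ₐ[ℂ] B) (hφ : Function.Injective φ) {a : A} (ha : IsUnit (φ a)) : IsUnit a := by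
  -- Spectral permanence: an injective homomorphism preserves the spectrum of a self-adjoint
  -- element. The general case follows because `a` is invertible as soon as both `star a * a` and `a
  -- * star a` are.
  have key (b : A) (hb : IsSelfAdjoint b) (h : IsUnit (φ b)) : IsUnit b := by
    rw [← spectrum.zero_notMem_iff ℝ] at h ⊢
    rwa [← hb.map_spectrum_real φ hφ]
  have h1 : IsUnit (star a * a) := key _ (.star_mul_self a) (by
    rw [map_mul, map_star]; exact ha.star.mul ha)
  have h2 : IsUnit (a * star a) := key _ (.mul_star_self a) (by
    rw [map_mul, map_star]; exact ha.mul ha.star)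
  obtain ⟨u, hu⟩ := h1
  obtain ⟨v, hv⟩ := h2
  refine isUnit_iff_exists_and_exists.2 ⟨⟨star a * (v⁻¹ : Aˣ), ?_⟩, ⟨(u⁻¹ : Aˣ) * star a, ?_⟩⟩
  · rw [← mul_assoc, ← hv, Units.mul_inv]
  · rw [mul_assoc, ← hu, Units.inv_mul]

/-! ## Stable rank one for products -/

theorem HasStableRankOne.prod {A B : Type*} [CStarAlgebra A] [CStarAlgebra B]
    (hA : HasStableRankOne A) (hB : HasStableRankOne B) : HasStableRankOne (A × B) := by
  have h := Dense.prod hA hB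
  refine h.mono fun x hx => ?_
  exact Prod.isUnit_iff.2 hx

theorem HasStableRankOne.pi {ι : Type*} [Fintype ι] {A : ι → Type*} [∀ i, CStarAlgebra (A i)]
    (hA : ∀ i, HasStableRankOne (A i)) : HasStableRankOne (∀ i, A i) := by
  have h : Dense (Set.univ.pi fun i => {a : A i | IsUnit a}) := dense_pi _ fun i _ => hA i
  exact h.mono fun x (hx : x ∈ Set.univ.pi _) => Pi.isUnit_iff.2 fun i => hx i trivial

/-! ## Separability and stable rank one for inductive limits -/

namespace CStarLimit

variable {A : ℕ → Type*} [∀ n, CStarAlgebra (A n)] (φ : ∀ n, A n →⋆ₐ[ℂ] A (n + 1))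

/-- The orbit of `a : A N` under the connecting maps, equal to `1` before stage `N`. -/
def orbit (N : ℕ) (a : A N) : ∀ n, A n
  -- The default value 1 before stage `N` makes `threadOf` unital and multiplicative on the nose.
  -- Additivity fails there, but transporting units and estimating norms at late stages do not need
  -- it.
  | 0 => if h : N = 0 then h ▸ a else 1
  | n + 1 => if h : N = n + 1 then h ▸ a else φ n (orbit N a n)

theorem orbit_self (N : ℕ) (a : A N) : orbit φ N a N = a := by
  cases N <;> simp [orbit]

theorem orbit_succ {N n : ℕ} (h : N ≤ n) (a : A N) :
    orbit φ N a (n + 1) = φ n (orbit φ N a n) := by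
  rw [orbit, dif_neg (by omega)]

theorem orbit_one (N n : ℕ) : orbit φ N 1 n = 1 := by
  induction n with
  | zero =>
    rw [orbit]
    split_ifs with h
    · subst h; rfl
    · rfl
  | succ n ih =>
    rw [orbit]
    split_ifs with h
    · subst h; rfl
    · rw [ih, map_one]

theorem orbit_mul (N n : ℕ) (a b : A N) :
    orbit φ N (a * b) n = orbit φ N a n * orbit φ N b n := by
  induction n with
  | zero =>
    simp only [orbit]
    split_ifs with h
    · subst h; rfl
    · rw [one_mul]
  | succ n ih =>
    simp only [orbit]
    split_ifs with h
    · subst h; rfl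
    · rw [ih, map_mul]

/-- The canonical map from stage `N` to threads. -/
def threadOf (N : ℕ) : A N →* Thread φ where
  toFun a := ⟨orbit φ N a, Filter.eventually_atTop.2 ⟨N, fun _ h => (orbit_succ φ h a).symm⟩⟩
  map_one' := Subtype.ext (funext fun n => orbit_one φ N n)
  map_mul' a b := Subtype.ext (funext fun n => orbit_mul φ N n a b)

variable {φ}

/-- From stage `N` on, both threads follow the connecting maps, which are contractive. The norms of
the terms of the difference therefore never exceed the one at stage `N`, and neither does their
limit. -/
theorem Thread.norm_sub_threadOf_le (x : Thread φ) {N : ℕ}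
    (hN : ∀ n ≥ N, φ n (x.term n) = x.term (n + 1)) (a : A N) :
    ‖x + -threadOf φ N a‖ ≤ ‖x.term N + -a‖ := by
  refine le_of_tendsto (Thread.tendsto_norm _) (Filter.eventually_atTop.2 ⟨N, fun n hn => ?_⟩)
  induction n, hn using Nat.le_induction with
  | base =>
    rw [Thread.term_add, Thread.term_neg]
    exact (congrArg (fun b => ‖x.term N + -b‖) (orbit_self φ N a)).le
  | succ n hn ih =>
    refine le_trans ?_ ih
    have h : (x + -threadOf φ N a).term (n + 1) = φ n ((x + -threadOf φ N a).term n) := by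
      simp only [Thread.term_add, Thread.term_neg, map_add, map_neg, hN n hn]
      congr 2
      exact orbit_succ φ hn a
    rw [h]
    exact NonUnitalStarAlgHom.norm_apply_le (φ n) _

/-- Elements that come from a dense subset of each stage are dense in the inductive limit. -/
theorem dense_iUnion_image (s : ∀ n, Set (A n)) (hs : ∀ n, Dense (s n)) :
    Dense (⋃ N, (fun a => mk (threadOf φ N a)) '' s N) := by
  refine ind isClosed_closure fun x => Metric.mem_closure_iff.2 fun ε hε => ?_
  obtain ⟨N, hN⟩ := Filter.eventually_atTop.1 x.2
  obtain ⟨a, ha, hd⟩ := Metric.mem_closure_iff.1 (hs N (x.term N)) ε hε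
  refine ⟨_, Set.mem_iUnion.2 ⟨N, a, ha, rfl⟩, ?_⟩
  have h : mk x - mk (threadOf φ N a) = mk (x + -threadOf φ N a) := by
    rw [sub_eq_add_neg, ← neg_one_smul ℂ (mk (threadOf φ N a)), ← mk_smul, ← mk_add,
      neg_one_smul]
  rw [dist_eq_norm, h, norm_mk]
  rw [dist_eq_norm, sub_eq_add_neg] at hd
  exact (x.norm_sub_threadOf_le hN a).trans_lt hd

/-- The dense set built from the units of the stages consists of units, because `threadOf` and `mk`
are unital and multiplicative. -/
theorem hasStableRankOne (h : ∀ n, HasStableRankOne (A n)) : HasStableRankOne (CStarLimit φ) := by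
  refine (dense_iUnion_image _ h).mono ?_
  rintro _ ⟨_, ⟨N, rfl⟩, a, ha, rfl⟩
  obtain ⟨b, h1, h2⟩ := isUnit_iff_exists.1 (IsUnit.map (threadOf φ N) ha)
  exact isUnit_iff_exists.2 ⟨mk b, by rw [← mk_mul, h1, mk_one], by rw [← mk_mul, h2, mk_one]⟩

theorem separableSpace [∀ n, TopologicalSpace.SeparableSpace (A n)] :
    TopologicalSpace.SeparableSpace (CStarLimit φ) :=
  ⟨_, Set.countable_iUnion fun n =>
      (TopologicalSpace.exists_countable_dense (A n)).choose_spec.1.image _,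
    dense_iUnion_image _ fun n => (TopologicalSpace.exists_countable_dense (A n)).choose_spec.2⟩

end CStarLimit

/-! ## Paths of invertible matrices -/

namespace Folding

open scoped Matrix.Norms.L2Operator unitInterval
open Polynomial

/-- A path of matrices with invertible end points can be approximated by paths of invertible
matrices with the same end points: approximate it by a polynomial path, and move the parameter
interval in the complex plane away from the zeros of the determinant. -/
theorem exists_path_isUnit {n : Type} [Fintype n] [DecidableEq n] (f : C(I, Matrix n n ℂ))
    (h0 : IsUnit (f 0)) (h1 : IsUnit (f 1)) {ε : ℝ} (hε : 0 < ε) :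
    ∃ g : C(I, Matrix n n ℂ), g 0 = f 0 ∧ g 1 = f 1 ∧ (∀ t, IsUnit (g t)) ∧ ‖f - g‖ < ε := by
  -- Degree 0 is excluded because the Bernstein approximation is then constant and need not match
  -- `f` at 1.
  obtain ⟨m, hm, hm0⟩ := ((((bernsteinApproximation_uniform f).eventually
    (Metric.ball_mem_nhds f hε)).and (Filter.eventually_ne_atTop 0))).exists
  -- As a matrix over `ℂ[X]`, the approximation extends to complex parameters and its determinant is
  -- one polynomial.
  let P : Matrix n n ℂ[X] := ∑ k : Fin (m + 1),
    bernsteinPolynomial ℂ m k • (f (bernstein.z k)).map C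
  let p (z : ℂ) : Matrix n n ℂ := (evalRingHom z).mapMatrix P
  have hp (z : ℂ) : p z = ∑ k : Fin (m + 1),
      (bernsteinPolynomial ℂ m k).eval z • f (bernstein.z k) := by
    simp only [p, P, map_sum]
    refine Finset.sum_congr rfl fun k _ => ?_
    ext i j
    simp
  have hpt (t : I) : p (t : ℝ) = bernsteinApproximation m f t := by
    rw [hp, bernsteinApproximation.apply]
    refine Finset.sum_congr rfl fun k _ => ?_
    ext i j
    simp [bernsteinPolynomial, bernstein_apply]
  have hpc : Continuous p := by
    rw [funext hp]
    fun_prop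
  have hp0 : p 0 = f 0 := by simpa using hpt 0
  have hp1 : p 1 = f 1 := by simpa [hm0] using hpt 1
  have hdet (z : ℂ) : (p z).det = P.det.eval z := (RingHom.map_det (evalRingHom z) P).symm
  have hP : P.det ≠ 0 := fun h => by
    have := (Matrix.isUnit_iff_isUnit_det _).1 (hp0 ▸ h0)
    simp [hdet, h] at this
  -- A parabolic arc from 0 to 1 with real part `t`; `δ = 0` gives the interval itself.
  let w (δ : ℝ) (t : I) : ℂ := (t : ℝ) + (δ * (t * (1 - t)) : ℝ) * Complex.I
  -- Currying makes the bent path depend continuously on `δ` in the uniform norm, so small `δ` keeps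
  -- it within `ε` of `f`.
  let G : C(ℝ, C(I, Matrix n n ℂ)) := ContinuousMap.curry
    ⟨fun x => p (w x.1 x.2), hpc.comp (by fun_prop)⟩
  have hG (δ : ℝ) (t : I) : G δ t = p (w δ t) := rfl
  have hG0 : G 0 = bernsteinApproximation m f := by
    ext1 t
    rw [hG, ← hpt]
    simp [w]
  have hnear : ∀ᶠ δ in nhds (0 : ℝ), G δ ∈ Metric.ball f ε :=
    (map_continuous G).continuousAt.eventually_mem
      (Metric.isOpen_ball.mem_nhds (by rw [hG0]; exact hm))
  -- If a root `z` equals `w δ t` with `0 < t < 1`, then `t = z.re` and `δ = z.im / (z.re * (1 -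
  -- z.re))`. Each root thus excludes a single `δ`; roots with real part 0 or 1 contribute a
  -- harmless extra value.
  let bad : Set ℝ := (fun z : ℂ => z.im / (z.re * (1 - z.re))) '' {z | P.det.IsRoot z}
  have hbad : bad.Finite := (finite_setOfPred_isRoot hP).image _
  obtain ⟨δ, hδ, hδ'⟩ := (hbad.countable.dense_compl ℝ).inter_nhds_nonempty hnear
  have e0 : w δ 0 = 0 := by simp [w]
  have e1 : w δ 1 = 1 := by simp [w]
  refine ⟨G δ, by rw [hG, e0, hp0], by rw [hG, e1, hp1], fun t => ?_, ?_⟩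
  · by_cases ht0 : t = 0
    · rwa [ht0, hG, e0, hp0]
    by_cases ht1 : t = 1
    · rwa [ht1, hG, e1, hp1]
    rw [hG, Matrix.isUnit_iff_isUnit_det, isUnit_iff_ne_zero, hdet]
    intro h
    refine hδ ⟨w δ t, h, ?_⟩
    have a : (t : ℝ) ≠ 0 := fun h => ht0 (Subtype.ext h)
    have b : 1 - (t : ℝ) ≠ 0 := fun h => ht1 (Subtype.ext (sub_eq_zero.1 h).symm)
    simp [w]
    field_simp
  · rw [← dist_eq_norm, dist_comm]
    exact hδ'

end Folding
end

noncomputable section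

namespace Folding

open scoped Matrix.Norms.L2Operator unitInterval CStarAlgebra
open Matrix

/-! ## Separability and stable rank one for the building blocks -/

/-- Entrywise application of `θ : A → M_q^{⊗ l}` to matrices, followed by the identification
`M_N(M_q^{⊗ l}) = M_N ⊗ M_q^{⊗ l}`. -/
def flatten {N : Type} [Fintype N] [DecidableEq N] {A : Type} [CStarAlgebra A] [PartialOrder A]
    [StarOrderedRing A] {q l : ℕ} (θ : A →⋆ₐ[ℂ] Mat q l) :
    CStarMatrix N N A →⋆ₐ[ℂ] Matrix (N × Idx q l) (N × Idx q l) ℂ where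
  toFun x := Matrix.of fun a b => θ (x a.1 b.1) a.2 b.2
  map_one' := by
    ext ⟨a, i⟩ ⟨b, j⟩
    change θ ((1 : Matrix N N A) a b) i j = _
    by_cases h : a = b <;> by_cases h' : i = j <;> simp [Matrix.one_apply, h, h']
  map_mul' x y := by
    ext ⟨a, i⟩ ⟨b, j⟩
    change θ ((x * y) a b) i j = _
    simp only [CStarMatrix.mul_apply, Matrix.mul_apply, map_sum, map_mul, Matrix.sum_apply,
      Fintype.sum_prod_type]
    rfl
  map_zero' := by
    ext ⟨a, i⟩ ⟨b, j⟩
    change θ 0 i j = 0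
    simp
  map_add' x y := by
    ext ⟨a, i⟩ ⟨b, j⟩
    change θ (x a b + y a b) i j = _
    rw [map_add]
    rfl
  commutes' c := by
    ext ⟨a, i⟩ ⟨b, j⟩
    change θ (if a = b then algebraMap ℂ A c else 0) i j = _
    by_cases h : a = b <;> by_cases h' : i = j <;>
      simp [h, h', AlgHomClass.commutes, Matrix.algebraMap_matrix_apply]
  map_star' x := by
    ext ⟨a, i⟩ ⟨b, j⟩
    change θ (star (x b a)) i j = star (θ (x b a) j i)
    rw [map_star]
    rfl

/-! ### Folding algebras as paths of scalar matrices with end point data -/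

section

variable {q : ℕ} (e : Proj q) (l : ℕ)

/-- The evaluation `f ↦ f(t)` on the folding algebra. -/
def evalAt (t : I) : FoldingAlgebra e l →⋆ₐ[ℂ] Mat q (l + 1) where
  toFun x := x.1.1 t
  map_one' := rfl
  map_mul' _ _ := rfl
  map_zero' := rfl
  map_add' _ _ := rfl
  commutes' _ := rfl
  map_star' _ := rfl

/-- The pair `(x₀, x₁)` of end point data of an element of the folding algebra. -/
def ends (k : Fin 2) : FoldingAlgebra e l →⋆ₐ[ℂ] Mat q l where
  toFun x := if k = 0 then x.1.2.1 else x.1.2.2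
  map_one' := by split_ifs <;> rfl
  map_mul' _ _ := by split_ifs <;> rfl
  map_zero' := by split_ifs <;> rfl
  map_add' _ _ := by split_ifs <;> rfl
  commutes' _ := by split_ifs <;> rfl
  map_star' _ := by split_ifs <;> rfl

variable {e l} in
theorem FoldingAlgebra.ext' {x y : FoldingAlgebra e l} (h : ∀ t, evalAt e l t x = evalAt e l t y)
    (h' : ∀ k, ends e l k x = ends e l k y) : x = y :=
  Subtype.ext (Prod.ext (ContinuousMap.ext h) (Prod.ext (h' 0) (h' 1)))

theorem continuous_evalAt (x : FoldingAlgebra e l) : Continuous fun t => evalAt e l t x :=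
  x.1.1.continuous

/-- The detour through second countability is needed because separability alone need not pass to
subspaces. -/
instance : TopologicalSpace.SeparableSpace (FoldingAlgebra e l) := by
  have : SecondCountableTopology (Mat q l) := inferInstanceAs (SecondCountableTopology (_ → _ → ℂ))
  have : SecondCountableTopology (Mat q (l + 1)) :=
    inferInstanceAs (SecondCountableTopology (_ → _ → ℂ))
  have : SecondCountableTopology (FoldingAlgebra e l) :=
    inferInstanceAs (SecondCountableTopology
      (StarAlgHom.equalizer (evEnds q l) (embEnds e l)))
  infer_instance

variable (N : Type) [Fintype N] [DecidableEq N]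

/-- The path and the end point data of a matrix over the folding algebra, as scalar matrices. -/
def realize : CStarMatrix N N (FoldingAlgebra e l) →⋆ₐ[ℂ]
    C(I, Matrix (N × Idx q (l + 1)) (N × Idx q (l + 1)) ℂ) ×
      (Fin 2 → Matrix (N × Idx q l) (N × Idx q l) ℂ) where
  toFun x := (⟨fun t => flatten (evalAt e l t) x, continuous_matrix fun a b =>
    (continuous_evalAt e l (x a.1 b.1)).matrix_elem a.2 b.2⟩, fun k => flatten (ends e l k) x)
  map_one' := Prod.ext (ContinuousMap.ext fun t => map_one (flatten (evalAt e l t)))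
    (funext fun k => map_one (flatten (ends e l k)))
  map_mul' x y := Prod.ext (ContinuousMap.ext fun t => map_mul (flatten (evalAt e l t)) x y)
    (funext fun k => map_mul (flatten (ends e l k)) x y)
  map_zero' := Prod.ext (ContinuousMap.ext fun t => map_zero (flatten (evalAt e l t)))
    (funext fun k => map_zero (flatten (ends e l k)))
  map_add' x y := Prod.ext (ContinuousMap.ext fun t => map_add (flatten (evalAt e l t)) x y)
    (funext fun k => map_add (flatten (ends e l k)) x y)
  commutes' c := Prod.ext
    (ContinuousMap.ext fun t => AlgHomClass.commutes (flatten (evalAt e l t)) c)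
    (funext fun k => AlgHomClass.commutes (flatten (ends e l k)) c)
  map_star' x := Prod.ext (ContinuousMap.ext fun t => map_star (flatten (evalAt e l t)) x)
    (funext fun k => map_star (flatten (ends e l k)) x)

/-- Since the end point data are recorded next to the path, injectivity of the embeddings $i_0,i_1$
is not needed. -/
theorem realize_injective : Function.Injective (realize e l N) := fun x y h => by
  have h1 := congrArg Prod.fst h
  have h2 := congrArg Prod.snd h
  refine CStarMatrix.ext fun a b => FoldingAlgebra.ext' (fun t => ?_) fun k => ?_
  · ext i j
    exact congrFun (congrFun (DFunLike.congr_fun h1 t) (a, i)) (b, j)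
  · ext i j
    exact congrFun (congrFun (congrFun h2 k) (a, i)) (b, j)

/-- A path with the same end points as a matrix over the folding algebra is realized by a matrix
over the folding algebra with the same end point data. -/
theorem exists_realize_eq (x : CStarMatrix N N (FoldingAlgebra e l))
    (g : C(I, Matrix (N × Idx q (l + 1)) (N × Idx q (l + 1)) ℂ))
    (h0 : g 0 = (realize e l N x).1 0) (h1 : g 1 = (realize e l N x).1 1) :
    ∃ y, realize e l N y = (g, (realize e l N x).2) := by
  let f (a b : N) : C(I, Mat q (l + 1)) := ⟨fun t => Matrix.of fun i j => g t (a, i) (b, j),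
    continuous_matrix fun i j => (map_continuous g).matrix_elem (a, i) (b, j)⟩
  have hf (a b : N) : (f a b, (x a b).1.2) ∈ StarAlgHom.equalizer (evEnds q l) (embEnds e l) := by
    -- The pullback condition sees only the values at 0 and 1 and the end point data, all of which
    -- agree with those of `x`.
    refine Eq.trans ?_ (x a b).2
    refine Prod.ext ?_ ?_ <;> ext i j
    · exact congrFun (congrFun h0 (a, i)) (b, j)
    · exact congrFun (congrFun h1 (a, i)) (b, j)
  exact ⟨CStarMatrix.ofMatrix fun a b => ⟨(f a b, (x a b).1.2), hf a b⟩, rfl⟩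

end

/-! ### The perturbation argument -/

/-- A C⋆-algebra of paths of matrices, together with some matrices that determine the end points of
the path, has stable rank one if it contains all modifications of its paths inside the interval. -/
theorem hasStableRankOne_of_exists_lift {A n m ι : Type} [CStarAlgebra A] [Fintype n]
    [DecidableEq n] [Fintype m] [DecidableEq m] [Fintype ι]
    (φ : A →⋆ₐ[ℂ] C(I, Matrix n n ℂ) × (ι → Matrix m m ℂ)) (hφ : Function.Injective φ)
    (hlift : ∀ (x : A) (g : C(I, Matrix n n ℂ)), g 0 = (φ x).1 0 → g 1 = (φ x).1 1 →
      ∃ y, φ y = (g, (φ x).2)) : HasStableRankOne A := by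
  refine fun x => Metric.mem_closure_iff.2 fun ε hε => ?_
  let X := φ x
  -- The scalars `c` for which `x + c` has a singular end value or singular end point data; finite,
  -- as spectra of matrices are.
  let bad : Set ℂ := spectrum ℂ (-X.1 0) ∪ spectrum ℂ (-X.1 1) ∪ ⋃ k, spectrum ℂ (-X.2 k)
  have hbad : bad.Finite := ((Matrix.finite_spectrum _).union (Matrix.finite_spectrum _)).union
    (Set.finite_iUnion fun k => Matrix.finite_spectrum _)
  -- Half of `ε` pays for the scalar shift, the other half for changing the path.
  have hsmall : ∀ᶠ c in nhds (0 : ℂ),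
      dist x (x + algebraMap ℂ A c) < ε / 2 := by
    have hc : Continuous fun c =>
        dist x (x + algebraMap ℂ A c) :=
      continuous_const.dist (continuous_const.add (continuous_algebraMap _ _))
    refine hc.continuousAt.eventually_lt continuousAt_const ?_
    simpa using hε
  obtain ⟨c, hc, hcε⟩ := (hbad.countable.dense_compl ℝ).inter_nhds_nonempty hsmall
  have hu {n : Type} [Fintype n] [DecidableEq n] {a : Matrix n n ℂ}
      (h : spectrum ℂ (-a) ⊆ bad) : IsUnit (a + algebraMap ℂ _ c) := by
    have := spectrum.notMem_iff.1 fun h' => hc (h h')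
    rwa [sub_neg_eq_add, add_comm] at this
  let x' := x + algebraMap ℂ A c
  have hx' : φ x' = X + algebraMap ℂ _ c := by
    rw [map_add, AlgHomClass.commutes]
  have h0 : IsUnit ((φ x').1 0) := by
    rw [hx']
    exact hu fun _ h => .inl (.inl h)
  have h1 : IsUnit ((φ x').1 1) := by
    rw [hx']
    exact hu fun _ h => .inl (.inr h)
  have h2 (k : ι) : IsUnit ((φ x').2 k) := by
    rw [hx']
    exact hu fun _ h => .inr (Set.mem_iUnion.2 ⟨k, h⟩)
  -- The end values stay fixed, so `hlift` gives an element with path `g` and the data of `x'`,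
  -- which are already invertible.
  obtain ⟨g, g0, g1, hg, hgε⟩ := exists_path_isUnit (φ x').1 h0 h1 (half_pos hε)
  obtain ⟨y, hy⟩ := hlift x' g g0 g1
  refine ⟨y, ?_, ?_⟩
  · refine φ.isUnit_of_isUnit_map hφ ?_
    rw [hy]
    exact Prod.isUnit_iff.2
      ⟨(ContinuousMap.isUnit_iff_forall_isUnit g).2 hg, Pi.isUnit_iff.2 h2⟩
  · have h : dist x' y < ε / 2 := by
      -- An injective homomorphism is isometric, and the images of `x'` and `y` differ only in the
      -- path.
      rw [dist_eq_norm, ← NonUnitalStarAlgHom.norm_map φ hφ,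
        map_sub, hy, Prod.norm_def]
      refine max_lt hgε ?_
      simpa using hε
    have h' : dist x x' < ε / 2 := hcε
    linarith [dist_triangle x x' y]

theorem hasStableRankOne_cstarMatrix {q : ℕ} (e : Proj q) (l : ℕ) (N : Type) [Fintype N]
    [DecidableEq N] : HasStableRankOne (CStarMatrix N N (FoldingAlgebra e l)) :=
  hasStableRankOne_of_exists_lift (realize e l N) (realize_injective e l N)
    (exists_realize_eq e l N)

/-- The C⋆-norm on matrices induces the entrywise topology, that of a finite product. -/
instance {q : ℕ} (e : Proj q) (l : ℕ) (N : Type) [Fintype N] [DecidableEq N] :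
    TopologicalSpace.SeparableSpace (CStarMatrix N N (FoldingAlgebra e l)) :=
  inferInstanceAs (TopologicalSpace.SeparableSpace (N → N → FoldingAlgebra e l))

/-- `C([0,1])` as the algebra of paths of `1 × 1` matrices, with no end point data. -/
def scalarRealize : C(I, ℂ) →⋆ₐ[ℂ] C(I, Matrix Unit Unit ℂ) × (Empty → Matrix Unit Unit ℂ) where
  toFun f := (⟨fun t => Matrix.scalar Unit (f t),
    continuous_matrix fun _ _ => by simpa using map_continuous f⟩, 0)
  map_one' := Prod.ext (by ext; simp) (Subsingleton.elim _ _)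
  map_mul' f g := Prod.ext (by ext; simp) (Subsingleton.elim _ _)
  map_zero' := Prod.ext (by ext; simp) (Subsingleton.elim _ _)
  map_add' f g := Prod.ext (by ext; simp) (Subsingleton.elim _ _)
  commutes' c := Prod.ext (by ext; simp) (Subsingleton.elim _ _)
  map_star' f := Prod.ext (by ext; simp) (Subsingleton.elim _ _)

/-- The lifting condition is automatic: every path of `1 × 1` matrices comes from a function. -/
theorem hasStableRankOne_continuousMap : HasStableRankOne C(I, ℂ) := by
  refine hasStableRankOne_of_exists_lift scalarRealize (fun f g h => ?_) fun f g _ _ => ?_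
  · ext t
    simpa [scalarRealize] using
      congrFun (congrFun (DFunLike.congr_fun (congrArg Prod.fst h) t) ()) ()
  · exact ⟨⟨fun t => g t () (), (map_continuous g).matrix_elem () ()⟩,
      Prod.ext (by ext; simp [scalarRealize]) (Subsingleton.elim _ _)⟩

/-! ### The limit algebras -/

variable (d : ℕ → I) (r : ℕ → ℕ) (e : ∀ k, Proj (qq k))

theorem hasStableRankOne_limitAlgebra : HasStableRankOne (LimitAlgebra d r e) :=
  CStarLimit.hasStableRankOne fun _ => HasStableRankOne.prod
    (HasStableRankOne.pi fun _ => hasStableRankOne_cstarMatrix _ _ _) hasStableRankOne_continuousMap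

theorem separableSpace_limitAlgebra : TopologicalSpace.SeparableSpace (LimitAlgebra d r e) :=
  CStarLimit.separableSpace

end Folding
end

theorem mainTheorem8
    (d : ℕ → unitInterval) (hd : DenseRange d)
    (r : ℕ → ℕ) (hr : StrictMono r) (hr0 : 2 ≤ r 0)
    (eA eB : ∀ k : ℕ, Folding.Proj (Folding.qq k))
    (hA : ∀ k, (eA k).1.rank = Folding.prmPred k)
    (hB : ∀ k, (eB k).1.rank = Folding.prm k) :
    (TopologicalSpace.SeparableSpace (Folding.LimitAlgebra d r eA) ∧
      (∃ u : Folding.LimitAlgebra d r eA, ∀ a, u * a = a ∧ a * u = a) ∧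
      HasStableRankOne (Folding.LimitAlgebra d r eA)) ∧
    (TopologicalSpace.SeparableSpace (Folding.LimitAlgebra d r eB) ∧
      (∃ u : Folding.LimitAlgebra d r eB, ∀ a, u * a = a ∧ a * u = a) ∧
      HasStableRankOne (Folding.LimitAlgebra d r eB)) :=
  ⟨⟨Folding.separableSpace_limitAlgebra d r eA, ⟨1, fun a => ⟨one_mul a, mul_one a⟩⟩,
      Folding.hasStableRankOne_limitAlgebra d r eA⟩,
    ⟨Folding.separableSpace_limitAlgebra d r eB, ⟨1, fun a => ⟨one_mul a, mul_one a⟩⟩,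
      Folding.hasStableRankOne_limitAlgebra d r eB⟩⟩
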